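/- All graphs are simple and locally finite. A graph is \emph{chordal} if it is connected and contains no induced cycle of length greater than $3$. Let $G=(V,E)$ be a chordal graph. A \emph{tree order} on $V$ is a partial order $\preccurlyeq$ such that $w\preccurlyeq u$ and $w\preccurlyeq v$ imply $u\preccurlyeq v$ or $v\preccurlyeq u$. The graph $G$ is \emph{left-handed} with respect to $\preccurlyeq$ if (i) adjacent vertices are comparable, and (ii) whenever $w\preccurlyeq u\preccurlyeq v$, $u\neq v$ and $vw\in E$, then $uv\in E$. The \emph{lesser neighbours} of $v$ are $L_v:=\{w\in V: w\preccurlyeq v,\ vw\in E\}$. Two vectors $\vec c,\vec p\in[0,1]^V$ are in \emph{equal correspondence} if $p_v=c_v\prod_{w\in L_v}(1-c_w)$ for all $v\in V$, and $\mathcal P_G^{=}$ is the set of those $\vec p\in[0,1]^V$ that are in equal correspondence with some $\vec c\in[0,1]^V$. A random field $X=(X_v)_{v\in V}$ with values in $\{0,1\}^V$ is \emph{$1$-dependent} if $(X_v)_{v\in U}$ and $(X_v)_{v\in W}$ are independent for all $U,W\subseteq V$ whose graph distance is greater than $1$. For $\vec p\in[0,1]^V$, let $G(\vec p)$ be the set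 of laws of $1$-dependent fields with $\mathbb P(X_v=1)=p_v$ for all $v$. \emph{Shearer's law} in $G(\vec p)$ is a law in $G(\vec p)$ such that, for every finite $W\subseteq V$, $$\mathbb P(X_v=0\text{ for all }v\in W)=\sum_{\substack{I\subseteq W\\ I\text{ independent in }G}}\ \prod_{w\in I}(-p_w).$$ \textbf{Theorem (Block factor construction of Shearer's law).} There is a tree order on $V$ with respect to which $G$ is left-handed. Fix any such order and let $\vec p\in[0,1]^V$. Then Shearer's law exists in $G(\vec p)$ if and only if $\vec p\in\mathcal P_G^{=}$. Moreover, if $\vec c$ is in equal correspondence with $\vec p$ and $(Y_v)_{v\in V}$ are independent $\{0,1\}$-valued random variables with $\mathbb P(Y_v=1)=c_v$ for all $v$, then the field $$X_v:=Y_v\prod_{w\in L_v}(1-Y_w),\qquad v\in V,$$ has Shearer's law in $G(\vec p)$. -/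

import Mathlib

open MeasureTheory ProbabilityTheory

namespace ShearerChordal

universe u v

/-- A graph is chordal if it contains no induced cycle of length greater than three. -/
def IsChordal {V : Type u} (G : SimpleGraph V) : Prop :=
  ∀ n : ℕ, 3 < n → IsEmpty (SimpleGraph.cycleGraph n ↪g G)

/-- A tree order: two elements with a common lower bound are comparable. -/
def IsTreeOrder (V : Type u) [PartialOrder V] : Prop :=
  ∀ w x y : V, w ≤ x → w ≤ y → y ≤ x ∨ x ≤ y

/-- Left-handedness of `G` with respect to the order on `V`. In the second condition the middle
vertex differs from the top one, as `G` has no loops. -/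
structure IsLeftHanded {V : Type u} [PartialOrder V] (G : SimpleGraph V) : Prop where
  comparable : ∀ x y : V, G.Adj x y → y ≤ x ∨ x ≤ y
  chain : ∀ w x y : V, w ≤ x → x < y → G.Adj y w → G.Adj x y

open Classical in
/-- The lesser neighbours of `x`: the neighbours `w` of `x` with `w ≤ x`. -/
noncomputable def lesserNeighbors {V : Type u} [PartialOrder V] (G : SimpleGraph V)
    [G.LocallyFinite] (x : V) : Finset V :=
  {w ∈ G.neighborFinset x | w ≤ x}

/-- The vectors `c, p ∈ [0,1]^V` are in equal correspondence:
`p x = c x * ∏ (1 - c w)`, the product being over the lesser neighbours `w` of `x`. -/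
structure EqualCorrespondence {V : Type u} [PartialOrder V] (G : SimpleGraph V)
    [G.LocallyFinite] (c p : V → ℝ) : Prop where
  left_mem : ∀ x, c x ∈ Set.Icc (0 : ℝ) 1
  right_mem : ∀ x, p x ∈ Set.Icc (0 : ℝ) 1
  eq : ∀ x, p x = c x * ∏ w ∈ lesserNeighbors G x, (1 - c w)

/-- The set of vectors `p` that are in equal correspondence with some vector `c`. -/
def equalSet {V : Type u} [PartialOrder V] (G : SimpleGraph V) [G.LocallyFinite] :
    Set (V → ℝ) :=
  {p | ∃ c : V → ℝ, EqualCorrespondence G c p}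

/-- A law `μ` on `{0,1}^V` is `1`-dependent: the subfields indexed by two vertex sets at graph
distance greater than one are independent. -/
def IsOneDependent {V : Type u} (G : SimpleGraph V) (μ : Measure (V → Fin 2)) : Prop :=
  ∀ U W : Set V, (∀ x ∈ U, ∀ y ∈ W, 1 < G.edist x y) →
    IndepFun (fun (ω : V → Fin 2) (x : U) => ω x) (fun (ω : V → Fin 2) (y : W) => ω y) μ

/-- The laws of `1`-dependent Bernoulli random fields on `G` with marginals `p`. -/
def oneDependentLaws {V : Type u} (G : SimpleGraph V) (p : V → ℝ) :
    Set (Measure (V → Fin 2)) :=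
  {μ | IsProbabilityMeasure μ ∧ IsOneDependent G μ ∧ ∀ x, μ.real {ω | ω x = 1} = p x}

open Classical in
/-- The weighted independent set polynomial of the subgraph of `G` induced by `W`: the sum over
the independent sets `I ⊆ W` of `∏ w ∈ I, (-p w)`. -/
noncomputable def indepSetPoly {V : Type u} (G : SimpleGraph V) (p : V → ℝ) (W : Finset V) : ℝ :=
  ∑ I ∈ W.powerset.filter (fun I : Finset V => G.IsIndepSet (I : Set V)), ∏ w ∈ I, (-p w)

/-- `μ` is Shearer's law in the class of `1`-dependent laws on `G` with marginals `p`: its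
avoidance probabilities are given by the independent set polynomial. -/
def IsShearerLaw {V : Type u} (G : SimpleGraph V) (p : V → ℝ) (μ : Measure (V → Fin 2)) : Prop :=
  μ ∈ oneDependentLaws G p ∧
    ∀ W : Finset V, μ.real {ω | ∀ x ∈ W, ω x = 0} = indepSetPoly G p W

/-- `Y` is a family of independent Bernoulli random variables with `ℙ(Y x = 1) = c x`. -/
structure IsIndepBernoulli {V : Type u} {Ω : Type v} [MeasurableSpace Ω] (c : V → ℝ)
    (Y : V → Ω → Fin 2) (μ : Measure Ω) : Prop where
  measurable : ∀ x, Measurable (Y x)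
  indep : iIndepFun Y μ
  marginal : ∀ x, μ.real {ω | Y x ω = 1} = c x

open Fin.CommRing in
/-- The block factor `X x = Y x * ∏ (1 - Y w)`, the product being over the lesser neighbours `w`
of `x`. On `{0,1}` the arithmetic of `Fin 2` used here agrees with that of the reals
(see `blockFactor_coe`). -/
noncomputable def blockFactor {V : Type u} {Ω : Type v} [PartialOrder V] (G : SimpleGraph V)
    [G.LocallyFinite] (Y : V → Ω → Fin 2) (x : V) (ω : Ω) : Fin 2 :=
  Y x ω * ∏ w ∈ lesserNeighbors G x, (1 - Y w ω)

theorem fin_two_mul_coe (a b : Fin 2) :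
    (((a * b : Fin 2) : ℕ) : ℝ) = ((a : ℕ) : ℝ) * ((b : ℕ) : ℝ) := by
  fin_cases a <;> fin_cases b <;> simp

theorem fin_two_one_sub_coe (a : Fin 2) :
    (((1 - a : Fin 2) : ℕ) : ℝ) = 1 - ((a : ℕ) : ℝ) := by
  fin_cases a <;> simp

open Fin.CommRing in
theorem blockFactor_coe {V : Type u} {Ω : Type v} [PartialOrder V] (G : SimpleGraph V)
    [G.LocallyFinite] (Y : V → Ω → Fin 2) (x : V) (ω : Ω) :
    ((blockFactor G Y x ω : ℕ) : ℝ) =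
      ((Y x ω : ℕ) : ℝ) * ∏ w ∈ lesserNeighbors G x, (1 - ((Y w ω : ℕ) : ℝ)) := by
  classical
  have key : ∀ s : Finset V, (((∏ w ∈ s, (1 - Y w ω) : Fin 2) : ℕ) : ℝ) =
      ∏ w ∈ s, (1 - ((Y w ω : ℕ) : ℝ)) := by
    intro s
    induction s using Finset.induction_on with
    | empty => simp
    | insert a s ha ih =>
      rw [Finset.prod_insert ha, Finset.prod_insert ha, ← ih, ← fin_two_one_sub_coe]
      exact fin_two_mul_coe _ _
  rw [← key]
  exact fin_two_mul_coe _ _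

end ShearerChordal

open ShearerChordal

/-! Three facts carry the theorem. Combinatorial: a finite chordal graph has a simplicial vertex
(Dirac), so it can be ordered with the greater neighbours of every vertex forming a clique. An
ultrafilter limit over finite vertex sets gives such a linear order on all of `V`, and reachability
along increasing edges is then a left-handed tree order (`IsChordal.exists_treeOrder`). Algebraic:
write Z(W) for the independent set polynomial. For m maximal in W, Z(W) = Z(W \ m) - p_m Z(W \
N[m]). Under equal correspondence restricted to W, both terms on the right are products by
induction, whence Z(W) = ∏ (1 - c_w) (`IsLeftHanded.indepSetPoly_eq_prod`). Conversely, if every Z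
is positive, c can be solved for on finite sets, one maximal vertex at a time; if every Z is only
nonnegative, p is first shrunk and a limit is taken by compactness (`IsLeftHanded.mem_equalSet`).
The avoidance probabilities of Shearer's law are nonnegative, which gives necessity. Probabilistic:
the block factor never has ones at adjacent vertices, and it is 1-dependent because distinct
vertices sharing a lesser neighbour are adjacent. These two properties make avoidance probabilities
satisfy the recursion of Z (`isShearerLaw_of_ae`). -/

namespace ShearerChordal

/-! ### Chordal graphs, elimination orders and tree orders -/

/-- The graph on `V` whose edges are the edges of `G` with both ends in `S`. -/
def restrict {V : Type*} (G : SimpleGraph V) (S : Set V) : SimpleGraph V where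
  Adj a b := G.Adj a b ∧ a ∈ S ∧ b ∈ S
  symm := ⟨fun _ _ h => ⟨h.1.symm, h.2.2, h.2.1⟩⟩
  loopless := ⟨fun _ h => h.1.ne rfl⟩

theorem restrict_mono {V : Type*} {G : SimpleGraph V} {S T : Set V} (h : S ⊆ T) :
    restrict G S ≤ restrict G T :=
  fun _ _ hab => ⟨hab.1, h hab.2.1, h hab.2.2⟩

/-- Distances along a walk of minimal length. -/
theorem dist_getVert {V : Type*} {H : SimpleGraph V} {x y : V} (w : H.Walk x y)
    (hw : w.length = H.dist x y) {i : ℕ} (hi : i ≤ w.length) : H.dist x (w.getVert i) = i := by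
  have h1 : H.dist x (w.getVert i) ≤ i := by
    simpa [hi] using SimpleGraph.dist_le (w.take i)
  have h2 : H.dist (w.getVert i) y ≤ w.length - i := by
    simpa using SimpleGraph.dist_le (w.drop i)
  have h3 := (w.take i).reachable.dist_triangle_left y
  omega

/-- In a chordal graph, two neighbours of `r` that are joined by a path avoiding the closed
neighbourhood of `r` are adjacent. -/
theorem IsChordal.adj_of_reachable {V : Type*} {G : SimpleGraph V} (hG : IsChordal G) {r x y : V}
    {C : Set V} (hr : ∀ a ∈ C, ¬ G.Adj r a ∧ a ≠ r) (hx : G.Adj r x) (hy : G.Adj r y)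
    (hxy : x ≠ y) (h : (restrict G (C ∪ {x, y})).Reachable x y) : G.Adj x y := by
  by_contra hadj
  -- A shortest path in `H` is induced, since distance from `x` equals position. Only its ends are
  -- adjacent to `r`, so closing it through `r` gives an induced cycle.
  set H := restrict G (C ∪ {x, y}) with hH
  obtain ⟨w, hw⟩ := h.exists_walk_length_eq_dist
  set k := w.length with hk
  have hd : ∀ i, i ≤ k → H.dist x (w.getVert i) = i := fun i hi => dist_getVert w hw hi
  have hk2 : 2 ≤ k := by
    rw [hw]
    exact h.one_lt_dist_of_ne_of_not_adj hxy (fun h' => hadj h'.1)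
  have hstep : ∀ i, i < k → H.Adj (w.getVert i) (w.getVert (i + 1)) :=
    fun i hi => w.adj_getVert_succ hi
  have hmem : ∀ i, i ≤ k → w.getVert i ∈ C ∪ {x, y} := by
    intro i hi
    rcases hi.lt_or_eq with hi | rfl
    · exact (hstep i hi).2.1
    · have := (hstep (k - 1) (by omega)).2.2
      rwa [show k - 1 + 1 = k by omega] at this
  have hinj : ∀ i j, i ≤ k → j ≤ k → w.getVert i = w.getVert j → i = j := by
    intro i j hi hj hij
    rw [← hd i hi, ← hd j hj, hij]
  have hadj_iff : ∀ i j, i ≤ k → j ≤ k →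
      (G.Adj (w.getVert i) (w.getVert j) ↔ i + 1 = j ∨ j + 1 = i) := by
    intro i j hi hj
    constructor
    · intro hij
      have hij' : H.Adj (w.getVert i) (w.getVert j) := ⟨hij, hmem i hi, hmem j hj⟩
      have h1 := (w.take i).reachable.dist_triangle_left (w.getVert j)
      have h2 := (w.take j).reachable.dist_triangle_left (w.getVert i)
      have h3 := SimpleGraph.dist_eq_one_iff_adj.2 hij'
      have h4 := SimpleGraph.dist_eq_one_iff_adj.2 hij'.symm
      have h5 : i ≠ j := fun h => hij.ne (by rw [h])
      rw [hd i hi, hd j hj] at h1 h2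
      omega
    · rintro (rfl | rfl)
      · exact (hstep i (by omega)).1
      · exact (hstep j (by omega)).1.symm
  have hr_iff : ∀ i, i ≤ k → (G.Adj r (w.getVert i) ↔ i = 0 ∨ i = k) := by
    intro i hi
    constructor
    · intro hri
      rcases hmem i hi with h | h | h
      · exact absurd hri (hr _ h).1
      · left
        exact hinj i 0 hi (by omega) (by simpa using h)
      · right
        exact hinj i k hi le_rfl (by rw [hk, w.getVert_length]; exact h)
    · rintro (rfl | rfl)
      · simpa using hx
      · rw [hk, w.getVert_length]; exact hy
  have hne : ∀ i, i ≤ k → w.getVert i ≠ r := by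
    intro i hi hri
    rcases hmem i hi with h | h | h
    · exact (hr _ h).2 hri
    · exact hx.ne (hri.symm.trans h)
    · exact hy.ne (hri.symm.trans h)
  -- Positions `0, …, k` run along the path and position `k + 1` is `r`; the cycle has length at
  -- least four as `k ≥ 2`.
  refine (hG (k + 2) (by omega)).false ⟨⟨fun i => if i.val ≤ k then w.getVert i.val else r, ?_⟩, ?_⟩
  · intro i j hij
    have hi := i.isLt
    have hj := j.isLt
    apply Fin.ext
    simp only at hij
    split_ifs at hij with h1 h2 h2
    · exact hinj _ _ h1 h2 hij
    · exact absurd hij (hne _ h1)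
    · exact absurd hij.symm (hne _ h2)
    · omega
  · intro i j
    have hi := i.isLt
    have hj := j.isLt
    rw [SimpleGraph.cycleGraph_adj']
    simp only [Fin.sub_def]
    change G.Adj (if i.val ≤ k then w.getVert i.val else r)
      (if j.val ≤ k then w.getVert j.val else r) ↔ _
    have key : ∀ a b : ℕ, a < k + 2 → b < k + 2 → ((k + 2 - b + a) % (k + 2) = 1 ↔
        a = b + 1 ∨ (a = 0 ∧ b = k + 1)) := by
      intro a b ha hb
      rcases le_or_gt b a with hab | hab
      · rw [show k + 2 - b + a = (a - b) + (k + 2) by omega, Nat.add_mod_right,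
          Nat.mod_eq_of_lt (by omega)]
        omega
      · rw [Nat.mod_eq_of_lt (by omega)]
        omega
    rw [key _ _ hi hj, key _ _ hj hi]
    split_ifs with h1 h2 h2
    · rw [hadj_iff _ _ h1 h2]; omega
    · rw [G.adj_comm, hr_iff _ h1]; omega
    · rw [hr_iff _ h2]; omega
    · simp only [SimpleGraph.irrefl, false_iff]; omega

/-- The vertex `s` is simplicial in the subgraph induced by `W`. -/
def IsSimplicial {V : Type*} (G : SimpleGraph V) (W : Finset V) (s : V) : Prop :=
  s ∈ W ∧ ∀ x ∈ W, ∀ y ∈ W, G.Adj s x → G.Adj s y → x ≠ y → G.Adj x y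

/-- In a finite chordal graph, if `r` is not adjacent to all other vertices, then there is a
simplicial vertex outside the closed neighbourhood of `r`. -/
theorem IsChordal.exists_isSimplicial_not_adj {V : Type*} {G : SimpleGraph V} (hG : IsChordal G)
    (n : ℕ) : ∀ (W : Finset V), W.card ≤ n → ∀ r ∈ W, ∀ u ∈ W, u ≠ r → ¬ G.Adj r u →
      ∃ s, IsSimplicial G W s ∧ s ≠ r ∧ ¬ G.Adj r s := by
  classical
  induction n with
  | zero =>
    intro W hW r hr
    rw [Finset.card_eq_zero.1 (Nat.le_zero.1 hW)] at hr
    simp at hr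
  | succ n ih =>
    intro W hW r hr u hu hur hru
    -- Dirac's argument: `C` is the component of `u` among the non-neighbours of `r`, and its
    -- boundary `S` consists of neighbours of `r`, hence is a clique. It suffices to find in `C` a
    -- simplicial vertex of the smaller set `W' = C ∪ S`, which contains all neighbours in `W` of
    -- vertices of `C`.
    set A : Set V := {a | a ∈ W ∧ a ≠ r ∧ ¬ G.Adj r a} with hA
    set C : Set V := {a | a ∈ A ∧ (restrict G A).Reachable u a} with hC
    have huC : u ∈ C := ⟨⟨hu, hur, hru⟩, SimpleGraph.Reachable.refl _⟩
    have hCr : ∀ a ∈ C, ¬ G.Adj r a ∧ a ≠ r := fun a ha => ⟨ha.1.2.2, ha.1.2.1⟩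
    have hCadj : ∀ a ∈ C, ∀ b ∈ A, G.Adj a b → b ∈ C := fun a ha b hb hab =>
      ⟨hb, ha.2.trans (SimpleGraph.Adj.reachable (G := restrict G A) ⟨hab, ha.1, hb⟩)⟩
    have hCreach : ∀ a ∈ C, (restrict G C).Reachable u a := by
      rintro a ⟨-, ⟨w⟩⟩
      have : ∀ (b a : V) (w : (restrict G A).Walk b a), b ∈ C →
          (restrict G C).Reachable b a := by
        intro b a w
        induction w with
        | nil => intro _; exact SimpleGraph.Reachable.refl _
        | cons h p ihp =>
          intro hb
          have := hCadj _ hb _ h.2.2 h.1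
          exact (SimpleGraph.Adj.reachable (G := restrict G C) ⟨h.1, hb, this⟩).trans (ihp this)
      exact this u a w huC
    set S : Set V := {x | x ∈ W ∧ x ∉ C ∧ ∃ a ∈ C, G.Adj a x} with hS
    have hSr : ∀ x ∈ S, G.Adj r x := by
      rintro x ⟨hxW, hxC, a, ha, hax⟩
      by_contra hrx
      refine hxC (hCadj a ha x ⟨hxW, ?_, hrx⟩ hax)
      rintro rfl
      exact (hCr a ha).1 hax.symm
    have hSclique : ∀ x ∈ S, ∀ y ∈ S, x ≠ y → G.Adj x y := by
      intro x hx y hy hxy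
      refine hG.adj_of_reachable hCr (hSr x hx) (hSr y hy) hxy ?_
      obtain ⟨-, -, a, ha, hax⟩ := hx
      obtain ⟨-, -, b, hb, hby⟩ := hy
      have hab := ((hCreach a ha).symm.trans (hCreach b hb)).mono
        (restrict_mono (Set.subset_union_left (t := {x, y})))
      refine (SimpleGraph.Adj.reachable ?_).trans (hab.trans (SimpleGraph.Adj.reachable ?_))
      · exact ⟨hax.symm, by simp, Or.inl ha⟩
      · exact ⟨hby, Or.inl hb, by simp⟩
    set W' : Finset V := W.filter (fun x => x ∈ C ∨ x ∈ S) with hW'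
    have hnb : ∀ a ∈ C, ∀ x ∈ W, G.Adj a x → x ∈ W' := by
      intro a ha x hx hax
      simp only [hW', Finset.mem_filter]
      refine ⟨hx, ?_⟩
      by_cases hxC : x ∈ C
      · exact Or.inl hxC
      · exact Or.inr ⟨hx, hxC, a, ha, hax⟩
    have hCW' : ∀ a ∈ C, a ∈ W' := fun a ha => by
      simp only [hW', Finset.mem_filter]
      exact ⟨ha.1.1, Or.inl ha⟩
    have hcard : W'.card ≤ n := by
      have : W' ⊂ W := by
        refine Finset.filter_ssubset.2 ⟨r, hr, ?_⟩
        rintro (h | h)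
        · exact (hCr r h).2 rfl
        · exact G.irrefl (hSr r h)
      have := Finset.card_lt_card this
      omega
    have lift : ∀ s ∈ C, IsSimplicial G W' s → ∃ s, IsSimplicial G W s ∧ s ≠ r ∧ ¬ G.Adj r s := by
      intro s hs hsim
      refine ⟨s, ⟨hs.1.1, ?_⟩, (hCr s hs).2, (hCr s hs).1⟩
      intro x hx y hy hsx hsy
      exact hsim.2 x (hnb s hs x hx hsx) y (hnb s hs y hy hsy) hsx hsy
    by_cases hcomplete : ∀ x ∈ W', ∀ y ∈ W', x ≠ y → G.Adj x y
    · exact lift u huC ⟨hCW' u huC, fun x hx y hy _ _ hxy => hcomplete x hx y hy hxy⟩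
    · push Not at hcomplete
      obtain ⟨x, hx, y, hy, hxy, hnxy⟩ := hcomplete
      obtain ⟨s, hs, -, -⟩ := ih W' hcard x hx y hy hxy.symm hnxy
      by_cases hsC : s ∈ C
      · exact lift s hsC hs
      · have hsS : s ∈ S := by
          have := hs.1
          simp only [hW', Finset.mem_filter] at this
          exact this.2.resolve_left hsC
        -- A simplicial vertex adjacent to everything would make `W'` a clique. Otherwise the
        -- induction hypothesis with `s` in the role of `r` gives a simplicial vertex not adjacent
        -- to `s`, so outside the clique `S`.
        by_cases hdom : ∀ v ∈ W', v ≠ s → G.Adj s v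
        · exfalso
          have hcl : ∀ v ∈ W', ∀ v' ∈ W', v ≠ v' → G.Adj v v' := by
            intro v hv v' hv' hvv'
            by_cases h1 : v = s
            · exact h1 ▸ hdom v' hv' (fun h => hvv' (h1.trans h.symm))
            · by_cases h2 : v' = s
              · exact h2 ▸ (hdom v hv h1).symm
              · exact hs.2 v hv v' hv' (hdom v hv h1) (hdom v' hv' h2) hvv'
          exact hnxy (hcl x hx y hy hxy)
        · push Not at hdom
          obtain ⟨v, hv, hvs, hsv⟩ := hdom
          obtain ⟨t, ht, hts, hst⟩ := ih W' hcard s hs.1 v hv hvs hsv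
          refine lift t ?_ ht
          have := ht.1
          simp only [hW', Finset.mem_filter] at this
          refine this.2.resolve_right fun htS => hst (hSclique s hsS t htS hts.symm)

/-- A nonempty finite chordal graph has a simplicial vertex. -/
theorem IsChordal.exists_isSimplicial {V : Type*} {G : SimpleGraph V} (hG : IsChordal G)
    {W : Finset V} (hW : W.Nonempty) : ∃ s, IsSimplicial G W s := by
  by_cases hcomplete : ∀ x ∈ W, ∀ y ∈ W, x ≠ y → G.Adj x y
  · obtain ⟨s, hs⟩ := hW
    exact ⟨s, hs, fun x hx y hy _ _ hxy => hcomplete x hx y hy hxy⟩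
  · push Not at hcomplete
    obtain ⟨x, hx, y, hy, hxy, hnxy⟩ := hcomplete
    obtain ⟨s, hs, -⟩ := hG.exists_isSimplicial_not_adj W.card W le_rfl x hx y hy hxy.symm hnxy
    exact ⟨s, hs⟩

/-- Finite chordal graphs have perfect elimination orderings. -/
theorem IsChordal.exists_rank {V : Type*} {G : SimpleGraph V} (hG : IsChordal G) (n : ℕ) :
    ∀ W : Finset V, W.card = n → ∃ f : V → ℕ, Set.InjOn f W ∧
      ∀ w ∈ W, ∀ x ∈ W, ∀ y ∈ W, G.Adj w x → G.Adj w y → f w < f x → f w < f y → x ≠ y →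
        G.Adj x y := by
  classical
  induction n with
  | zero =>
    intro W hW
    rw [Finset.card_eq_zero] at hW
    subst hW
    exact ⟨fun _ => 0, by simp, by simp⟩
  | succ n ih =>
    intro W hW
    obtain ⟨s, hs⟩ := hG.exists_isSimplicial (W := W) (Finset.card_pos.1 (by omega))
    obtain ⟨f, hinj, hf⟩ := ih (W.erase s) (by rw [Finset.card_erase_of_mem hs.1]; omega)
    -- The simplicial vertex is eliminated first, so it is never a greater neighbour of another
    -- vertex.
    refine ⟨fun v => if v = s then 0 else f v + 1, ?_, ?_⟩
    · intro a ha b hb hab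
      simp only at hab
      split_ifs at hab with h1 h2 h2
      · rw [h1, h2]
      · exact hinj (by simpa using ⟨ha, h1⟩) (by simpa using ⟨hb, h2⟩) (by omega)
    · intro w hw x hx y hy hwx hwy h1 h2 hxy
      have hxs : x ≠ s := by rintro rfl; simp at h1
      have hys : y ≠ s := by rintro rfl; simp at h2
      by_cases hws : w = s
      · subst hws
        exact hs.2 x hx y hy hwx hwy hxy
      · simp only [if_neg hxs, if_neg hys, if_neg hws] at h1 h2
        exact hf w (by simp [hws, hw]) x (by simp [hxs, hx]) y (by simp [hys, hy]) hwx hwy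
          (by omega) (by omega) hxy

/-- Every chordal graph has a linear order in which the greater neighbours of each vertex form a
clique. -/
theorem IsChordal.exists_elimination_order {V : Type*} {G : SimpleGraph V} (hG : IsChordal G) :
    ∃ R : V → V → Prop, (∀ a, ¬ R a a) ∧ (∀ a b c, R a b → R b c → R a c) ∧
      (∀ a b, a ≠ b → R a b ∨ R b a) ∧
      ∀ w x y, G.Adj w x → G.Adj w y → R w x → R w y → x ≠ y → G.Adj x y := by
  classical
  choose f hinj hf using fun W : Finset V => hG.exists_rank W.card W rfl
  -- Each required property involves finitely many vertices, so it passes to the limit of the finite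
  -- orders; totality is where an ultrafilter is needed.
  let U : Ultrafilter (Finset V) := Ultrafilter.of Filter.atTop
  have hmem : ∀ a, ∀ᶠ W in (U : Filter (Finset V)), a ∈ W := by
    intro a
    refine Filter.Eventually.filter_mono (Ultrafilter.of_le _) ?_
    filter_upwards [Filter.eventually_ge_atTop {a}] with W hW
    exact hW (by simp)
  refine ⟨fun a b => ∀ᶠ W in (U : Filter (Finset V)), f W a < f W b, ?_, ?_, ?_, ?_⟩
  · intro a h
    obtain ⟨W, hW⟩ := h.exists
    exact lt_irrefl _ hW
  · intro a b c h1 h2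
    filter_upwards [h1, h2] with W h1 h2 using h1.trans h2
  · intro a b hab
    rw [← Ultrafilter.eventually_or]
    filter_upwards [hmem a, hmem b] with W ha hb
    exact lt_or_gt_of_ne fun h => hab (hinj W ha hb h)
  · intro w x y hwx hwy h1 h2 hxy
    obtain ⟨W, hw, hx, hy, h1, h2⟩ :=
      ((hmem w).and ((hmem x).and ((hmem y).and (h1.and h2)))).exists
    exact hf W w hw x hx y hy hwx hwy h1 h2 hxy

/-- Every chordal graph is left-handed with respect to some tree order. -/
theorem IsChordal.exists_treeOrder {V : Type*} {G : SimpleGraph V} (hG : IsChordal G) :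
    ∃ _ : PartialOrder V, IsTreeOrder V ∧ IsLeftHanded G := by
  obtain ⟨R, hirr, htrans, htot, hclique⟩ := hG.exists_elimination_order
  set r : V → V → Prop := fun a b => G.Adj a b ∧ R a b with hr
  have hR : ∀ a b, Relation.ReflTransGen r a b → a = b ∨ R a b := by
    intro a b h
    induction h with
    | refl => exact Or.inl rfl
    | tail _ h ih =>
      rcases ih with rfl | ih
      · exact Or.inr h.2
      · exact Or.inr (htrans _ _ _ ih h.2)
  have hanti : ∀ a b, Relation.ReflTransGen r a b → Relation.ReflTransGen r b a → a = b := by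
    intro a b h1 h2
    rcases hR a b h1 with h | h
    · exact h
    rcases hR b a h2 with h' | h'
    · exact h'.symm
    · exact absurd (htrans _ _ _ h h') (hirr a)
  have hadj : ∀ a b, G.Adj a b → r a b ∨ r b a := fun a b hab =>
    (htot a b hab.ne).imp (fun h => ⟨hab, h⟩) (fun h => ⟨hab.symm, h⟩)
  let P : PartialOrder V :=
    { le := Relation.ReflTransGen r
      le_refl := fun _ => Relation.ReflTransGen.refl
      le_trans := fun _ _ _ => Relation.ReflTransGen.trans
      le_antisymm := hanti }
  have hle : ∀ {a b : V}, r a b → a ≤ b := fun h => Relation.ReflTransGen.single h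
  refine ⟨P, ?_, ?_, ?_⟩
  -- Two increasing paths leave the same vertex. Their second vertices `b`, `b'` are equal or, as
  -- greater neighbours of one vertex, adjacent; the edge between them lets the common start move up
  -- to `b` or to `b'`.
  · have main : ∀ (w x : V), Relation.ReflTransGen r w x → ∀ y, Relation.ReflTransGen r w y →
        y ≤ x ∨ x ≤ y := by
      intro w x hx
      induction hx using Relation.ReflTransGen.head_induction_on with
      | refl => exact fun y hy => Or.inr hy
      | head h hbx ih =>
        rename_i a b
        intro y hy
        induction hy using Relation.ReflTransGen.head_induction_on with
        | refl => exact Or.inl (Relation.ReflTransGen.head h hbx)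
        | head h' hby ih' =>
          rename_i a' b'
          by_cases hbb : b = b'
          · exact ih y (hbb ▸ hby)
          · rcases hadj b b' (hclique a' b b' h.1 h'.1 h.2 h'.2 hbb) with h2 | h2
            · exact ih y (Relation.ReflTransGen.head h2 hby)
            · exact ih' h2
    exact fun w x y hx hy => main w x hx y hy
  · intro x y hxy
    exact (hadj x y hxy).symm.imp hle hle
  · intro w x y hwx hxy hyw
    have hwx' : Relation.ReflTransGen r w x := hwx
    induction hwx' using Relation.ReflTransGen.head_induction_on with
    | refl => exact hyw.symm
    -- Adjacency to `y` is carried up the path: `b` and `y` are both greater neighbours of `a`.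
    | head h hbx ih =>
      rename_i a b
      have hby : b < y := lt_of_le_of_lt hbx hxy
      refine ih hbx ?_
      have hay : R a y := by
        rcases hR a y ((hle h).trans hby.le) with h' | h'
        · exact absurd h' hyw.ne.symm
        · exact h'
      exact (hclique a b y h.1 hyw.symm h.2 hay hby.ne).symm

end ShearerChordal

/-! ### The independent set polynomial and equal correspondence -/

namespace ShearerChordal

theorem indepSetPoly_empty {V : Type*} (G : SimpleGraph V) (p : V → ℝ) :
    indepSetPoly G p ∅ = 1 := by
  classical
  simp [indepSetPoly, Finset.filter_singleton]

theorem indepSetPoly_congr {V : Type*} (G : SimpleGraph V) {p q : V → ℝ} {W : Finset V}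
    (h : ∀ x ∈ W, p x = q x) : indepSetPoly G p W = indepSetPoly G q W := by
  classical
  refine Finset.sum_congr rfl fun I hI => Finset.prod_congr rfl fun w hw => ?_
  rw [h w (Finset.mem_powerset.1 (Finset.mem_filter.1 hI).1 hw)]

open Classical in
/-- The deletion recursion of the independent set polynomial. -/
theorem indepSetPoly_insert {V : Type*} (G : SimpleGraph V) (p : V → ℝ) {W : Finset V} {v : V}
    (hv : v ∉ W) : indepSetPoly G p (insert v W) =
      indepSetPoly G p W - p v * indepSetPoly G p {x ∈ W | ¬ G.Adj v x} := by
  have hindep : ∀ I ∈ W.powerset, (G.IsIndepSet ((insert v I : Finset V) : Set V) ↔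
      G.IsIndepSet (I : Set V) ∧ ∀ x ∈ I, ¬ G.Adj v x) := by
    intro I hI
    have hvI : v ∉ I := fun h => hv (Finset.mem_powerset.1 hI h)
    rw [SimpleGraph.IsIndepSet, SimpleGraph.IsIndepSet, Finset.coe_insert,
      Set.pairwise_insert]
    refine and_congr_right fun _ => forall₂_congr fun x hx => ?_
    have hvx : v ≠ x := fun h => hvI (h ▸ hx)
    simp [hvx, G.adj_comm x v]
  have hset : W.powerset.filter (fun I : Finset V => G.IsIndepSet ((insert v I : Finset V) : Set V))
      = ({x ∈ W | ¬ G.Adj v x} : Finset V).powerset.filter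
        (fun I : Finset V => G.IsIndepSet (I : Set V)) := by
    ext I
    simp only [Finset.mem_filter, Finset.mem_powerset, Finset.subset_iff]
    constructor
    · rintro ⟨h1, h2⟩
      rw [hindep I (Finset.mem_powerset.2 h1)] at h2
      exact ⟨fun x hx => ⟨h1 hx, h2.2 x hx⟩, h2.1⟩
    · rintro ⟨h1, h2⟩
      have h3 : I ⊆ W := fun x hx => (h1 hx).1
      exact ⟨fun x hx => h3 hx,
        (hindep I (Finset.mem_powerset.2 h3)).2 ⟨h2, fun x hx => (h1 hx).2⟩⟩
  simp only [indepSetPoly]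
  rw [Finset.sum_filter, Finset.sum_powerset_insert hv, ← Finset.sum_filter, ← Finset.sum_filter,
    hset, sub_eq_add_neg, ← neg_mul, Finset.mul_sum]
  congr 1
  refine Finset.sum_congr rfl fun I hI => Finset.prod_insert fun h => hv ?_
  exact (Finset.mem_filter.1 (Finset.mem_powerset.1 (Finset.mem_filter.1 hI).1 h)).1

/-- The polynomial is affine in the weight of `v`, and weight zero amounts to deleting `v`; scaling
that weight by `t` therefore interpolates between the two. -/
theorem indepSetPoly_insert_of_eq_mul {V : Type*} [DecidableEq V] (G : SimpleGraph V)
    {p q : V → ℝ} {t : ℝ} {W : Finset V} {v : V} (hv : v ∉ W) (hq : ∀ x, x ≠ v → q x = p x)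
    (hqv : q v = t * p v) : indepSetPoly G q (insert v W) =
      t * indepSetPoly G p (insert v W) + (1 - t) * indepSetPoly G p W := by
  classical
  have h : ∀ x ∈ W, q x = p x := fun x hx => hq x fun h => hv (h ▸ hx)
  have e : ∀ p : V → ℝ, indepSetPoly G p (insert v W) =
      indepSetPoly G p W - p v * indepSetPoly G p {x ∈ W | ¬ G.Adj v x} := fun p => by
    convert indepSetPoly_insert G p hv
  rw [e, e, indepSetPoly_congr G h,
    indepSetPoly_congr G (fun x hx => h x (Finset.mem_filter.1 hx).1), hqv]
  ring

/-- If the independent set polynomials are nonnegative at `p`, then they are positive at `t * p`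
for `t < 1`. -/
theorem indepSetPoly_mul_pos {V : Type*} (G : SimpleGraph V) {p : V → ℝ}
    (hp : ∀ W, 0 ≤ indepSetPoly G p W) {t : ℝ} (h0 : 0 ≤ t) (h1 : t < 1) (W : Finset V) :
    0 < indepSetPoly G (fun x => t * p x) W := by
  classical
  -- The weights are scaled one vertex at a time, `A` being those already scaled. Each scaling puts
  -- weight `1 - t > 0` on the polynomial with that vertex deleted, so positivity spreads from the
  -- empty set.
  have key : ∀ A S : Finset V, 0 ≤ indepSetPoly G (fun x => if x ∈ A then t * p x else p x) S ∧
      (S ⊆ A → 0 < indepSetPoly G (fun x => if x ∈ A then t * p x else p x) S) := by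
    intro A
    induction A using Finset.induction_on with
    | empty =>
      intro S
      refine ⟨by simpa using hp S, fun h => ?_⟩
      rw [Finset.subset_empty.1 h, indepSetPoly_empty]
      exact one_pos
    | insert v A hv ih =>
      intro S
      by_cases hS : v ∈ S
      · rw [← Finset.insert_erase hS, indepSetPoly_insert_of_eq_mul G
          (t := t) (p := fun x => if x ∈ A then t * p x else p x) (Finset.notMem_erase v S)
          (fun x hx => by simp [hx]) (by simp [hv])]
        have h2 := ih (insert v (S.erase v))
        have h3 := ih (S.erase v)
        have h4 : 0 < 1 - t := by linarith
        refine ⟨add_nonneg (mul_nonneg h0 h2.1) (mul_nonneg h4.le h3.1), fun h => ?_⟩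
        refine add_pos_of_nonneg_of_pos (mul_nonneg h0 h2.1) (mul_pos h4 (h3.2 ?_))
        exact Finset.subset_insert_iff.1 ((Finset.insert_erase hS) ▸ h)
      · rw [indepSetPoly_congr G (q := fun x => if x ∈ A then t * p x else p x)
          (fun x hx => by simp [show x ≠ v from fun h => hS (h ▸ hx)])]
        exact ⟨(ih S).1, fun h => (ih S).2 ((Finset.subset_insert_iff_of_notMem hS).1 h)⟩
  have := (key W W).2 subset_rfl
  rwa [indepSetPoly_congr G (q := fun x => t * p x) (fun x hx => by simp [hx])] at this

/-- In a left-handed graph, the greater neighbours of a vertex form a clique. -/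
theorem IsLeftHanded.adj_of_le {V : Type*} [PartialOrder V] {G : SimpleGraph V}
    (hG : IsLeftHanded G) (hV : IsTreeOrder V) {w x y : V} (hx : w ≤ x) (hy : w ≤ y)
    (hxw : G.Adj x w) (hyw : G.Adj y w) (hxy : x ≠ y) : G.Adj x y := by
  rcases hV w x y hx hy with h | h
  · exact (hG.chain w y x hy (lt_of_le_of_ne h hxy.symm) hxw).symm
  · exact hG.chain w x y hx (lt_of_le_of_ne h hxy) hyw

open Classical in
/-- On a finite set of vertices, equal correspondence turns the independent set polynomial into a
product. -/
theorem IsLeftHanded.indepSetPoly_eq_prod {V : Type*} [PartialOrder V] {G : SimpleGraph V}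
    (hG : IsLeftHanded G) (hV : IsTreeOrder V) {c p : V → ℝ} (W : Finset V)
    (h : ∀ x ∈ W, p x = c x * ∏ w ∈ W with w ≤ x ∧ G.Adj x w, (1 - c w)) :
    indepSetPoly G p W = ∏ w ∈ W, (1 - c w) := by
  induction W using Finset.strongInduction with
  | H W ih =>
  rcases W.eq_empty_or_nonempty with rfl | hne
  · simp [indepSetPoly_empty]
  obtain ⟨m, hm⟩ := W.exists_maximal hne
  have hmax : ∀ x ∈ W, m ≤ x → x = m := fun x hx hmx => le_antisymm (hm.2 hx hmx) hmx
  have hle : ∀ x ∈ W, G.Adj m x → x ≤ m := fun x hx hadj =>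
    (hG.comparable m x hadj).resolve_right fun h => hadj.ne (hmax x hx h).symm
  have hsub : ({x ∈ W.erase m | ¬ G.Adj m x} : Finset V) ⊂ W :=
    (Finset.filter_subset _ _).trans_ssubset (Finset.erase_ssubset hm.1)
  have e1 : indepSetPoly G p (W.erase m) = ∏ w ∈ W.erase m, (1 - c w) := by
    refine ih _ (Finset.erase_ssubset hm.1) fun x hx => ?_
    obtain ⟨hxm, hxW⟩ := Finset.mem_erase.1 hx
    rw [h x hxW]
    congr 1
    refine Finset.prod_congr (Finset.ext fun w => ?_) fun _ _ => rfl
    simp only [Finset.mem_filter, Finset.mem_erase]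
    refine ⟨fun hw => ⟨⟨?_, hw.1⟩, hw.2⟩, fun hw => ⟨hw.1.2, hw.2⟩⟩
    rintro rfl
    exact hxm (hmax x hxW hw.2.1)
  -- No factor is lost by deleting the neighbours of `m`: a lesser neighbour of `x` that is also
  -- adjacent to `m` would force `x` to be adjacent to `m`.
  have e2 : indepSetPoly G p {x ∈ W.erase m | ¬ G.Adj m x} =
      ∏ w ∈ W.erase m with ¬ G.Adj m w, (1 - c w) := by
    refine ih _ hsub fun x hx => ?_
    obtain ⟨hx', hmx⟩ := Finset.mem_filter.1 hx
    obtain ⟨hxm, hxW⟩ := Finset.mem_erase.1 hx'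
    rw [h x hxW]
    congr 1
    refine Finset.prod_congr (Finset.ext fun w => ?_) fun _ _ => rfl
    simp only [Finset.mem_filter, Finset.mem_erase]
    refine ⟨fun hw => ⟨⟨⟨?_, hw.1⟩, fun hmw => ?_⟩, hw.2⟩, fun hw => ⟨hw.1.1.2, hw.2⟩⟩
    · rintro rfl
      exact hxm (hmax x hxW hw.2.1)
    · exact hmx (hG.adj_of_le hV (hle w hw.1 hmw) hw.2.1 hmw hw.2.2 (Ne.symm hxm))
  have e3 : (W.filter fun w => w ≤ m ∧ G.Adj m w) = (W.erase m).filter fun w => G.Adj m w := by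
    ext w
    simp only [Finset.mem_filter, Finset.mem_erase]
    exact ⟨fun hw => ⟨⟨hw.2.2.ne.symm, hw.1⟩, hw.2.2⟩, fun hw => ⟨hw.1.2, hle w hw.1.2 hw.2, hw.2⟩⟩
  have e4 := Finset.prod_filter_mul_prod_filter_not (W.erase m) (fun w => G.Adj m w)
    (fun w => 1 - c w)
  rw [← Finset.mul_prod_erase W _ hm.1]
  conv_lhs => rw [← Finset.insert_erase hm.1]
  rw [indepSetPoly_insert G p (Finset.notMem_erase m W), e1, e2, h m hm.1, e3, ← e4]
  ring

open Classical in
/-- On a finite set of vertices with positive independent set polynomials, equal correspondence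
can be solved. -/
theorem IsLeftHanded.exists_finite_correspondence {V : Type*} [PartialOrder V] {G : SimpleGraph V}
    (hG : IsLeftHanded G) (hV : IsTreeOrder V) {p : V → ℝ} (hp : ∀ x, 0 ≤ p x)
    (hpos : ∀ W, 0 < indepSetPoly G p W) (W : Finset V) :
    ∃ c : V → ℝ, (∀ x, c x ∈ Set.Icc (0 : ℝ) 1) ∧
      ∀ x ∈ W, p x = c x * ∏ w ∈ W with w ≤ x ∧ G.Adj x w, (1 - c w) := by
  induction W using Finset.strongInduction with
  | H W ih =>
  rcases W.eq_empty_or_nonempty with rfl | hne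
  · exact ⟨0, by simp, by simp⟩
  obtain ⟨m, hm⟩ := W.exists_maximal hne
  have hmax : ∀ x ∈ W, m ≤ x → x = m := fun x hx hmx => le_antisymm (hm.2 hx hmx) hmx
  obtain ⟨c, hc, hcp⟩ := ih _ (Finset.erase_ssubset hm.1)
  -- Being maximal, `m` enters no other equation, so the value there must be `p m / Q`. Positivity
  -- on `W.erase m` makes `Q` positive, and positivity on `W` bounds the quotient by one.
  set Q : ℝ := ∏ w ∈ W with w ≤ m ∧ G.Adj m w, (1 - c w) with hQ
  have hprod := hG.indepSetPoly_eq_prod hV _ hcp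
  have hlt : ∀ x ∈ W.erase m, 0 < 1 - c x := by
    intro x hx
    refine lt_of_le_of_ne (by linarith [(hc x).2]) fun h0 => ?_
    exact (hprod ▸ hpos (W.erase m)).ne' (Finset.prod_eq_zero hx h0.symm)
  have hmL : ∀ w ∈ W, w ≤ m ∧ G.Adj m w → w ∈ W.erase m := fun w hw h =>
    Finset.mem_erase.2 ⟨h.2.ne.symm, hw⟩
  have hQpos : 0 < Q := Finset.prod_pos fun w hw =>
    hlt w (hmL w (Finset.mem_filter.1 hw).1 (Finset.mem_filter.1 hw).2)
  have hlocal : ∀ d : ℝ, ∀ x ∈ W, x ≠ m →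
      p x = Function.update c m d x * ∏ w ∈ W with w ≤ x ∧ G.Adj x w,
        (1 - Function.update c m d w) := by
    intro d x hx hxm
    rw [Function.update_of_ne hxm, hcp x (Finset.mem_erase.2 ⟨hxm, hx⟩)]
    congr 1
    have hne : ∀ w, w ≤ x → w ≠ m := by
      rintro w hw rfl
      exact hxm (hmax x hx hw)
    refine Finset.prod_congr (Finset.ext fun w => ?_) fun w hw => ?_
    · simp only [Finset.mem_filter, Finset.mem_erase]
      exact ⟨fun hw => ⟨hw.1.2, hw.2⟩, fun hw => ⟨⟨hne w hw.2.1, hw.1⟩, hw.2⟩⟩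
    · rw [Function.update_of_ne (hne w (Finset.mem_filter.1 hw).2.1)]
  have htop : ∀ d : ℝ, ∏ w ∈ W with w ≤ m ∧ G.Adj m w, (1 - Function.update c m d w) = Q := by
    intro d
    refine Finset.prod_congr rfl fun w hw => ?_
    rw [Function.update_of_ne (Finset.mem_filter.1 hw).2.2.ne.symm]
  have hall : ∀ x ∈ W, p x = Function.update c m (p m / Q) x * ∏ w ∈ W with w ≤ x ∧ G.Adj x w,
      (1 - Function.update c m (p m / Q) w) := by
    intro x hx
    by_cases hxm : x = m
    · subst hxm
      rw [htop, Function.update_self, div_mul_cancel₀ _ hQpos.ne']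
    · exact hlocal _ x hx hxm
  refine ⟨Function.update c m (p m / Q), fun x => ?_, hall⟩
  by_cases hxm : x = m
  · subst hxm
    rw [Function.update_self]
    refine ⟨div_nonneg (hp x) hQpos.le, ?_⟩
    have h1 := hpos W
    rw [hG.indepSetPoly_eq_prod hV W hall, ← Finset.mul_prod_erase W _ hm.1,
      Function.update_self] at h1
    have h2 : 0 < ∏ w ∈ W.erase x, (1 - Function.update c x (p x / Q) w) := by
      refine Finset.prod_pos fun w hw => ?_
      rw [Function.update_of_ne (Finset.mem_erase.1 hw).1]
      exact hlt w hw
    linarith [pos_of_mul_pos_left h1 h2.le]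
  · rw [Function.update_of_ne hxm]
    exact hc x

theorem mem_lesserNeighbors {V : Type*} [PartialOrder V] {G : SimpleGraph V} [G.LocallyFinite]
    {x w : V} : w ∈ lesserNeighbors G x ↔ w ≤ x ∧ G.Adj x w := by
  classical
  simp [lesserNeighbors, and_comm]

open Filter Topology in
/-- Nonnegativity of the independent set polynomials is sufficient for equal correspondence. -/
theorem IsLeftHanded.mem_equalSet {V : Type*} [PartialOrder V] {G : SimpleGraph V}
    [G.LocallyFinite] (hG : IsLeftHanded G) (hV : IsTreeOrder V) {p : V → ℝ}
    (hp : ∀ x, p x ∈ Set.Icc (0 : ℝ) 1) (hZ : ∀ W, 0 ≤ indepSetPoly G p W) :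
    p ∈ equalSet G := by
  classical
  -- Shrinking by `t n < 1` turns nonnegativity into the strict positivity needed for finite sets.
  -- Both the finite set and `n` then go to infinity along one ultrafilter, with limits in the
  -- compact interval.
  let t : ℕ → ℝ := fun n => n / (n + 1)
  have ht0 : ∀ n, 0 ≤ t n := fun n => by positivity
  have ht1 : ∀ n, t n < 1 := fun n => by
    rw [div_lt_one (by positivity)]
    linarith
  choose c hc hcp using fun i : Finset V × ℕ =>
    hG.exists_finite_correspondence hV (p := fun x => t i.2 * p x)
      (fun x => mul_nonneg (ht0 _) (hp x).1)
      (fun W => indepSetPoly_mul_pos G hZ (ht0 i.2) (ht1 i.2) W) i.1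
  let U : Ultrafilter (Finset V × ℕ) := Ultrafilter.of (atTop ×ˢ atTop)
  have hU : (U : Filter (Finset V × ℕ)) ≤ atTop ×ˢ atTop := Ultrafilter.of_le _
  have hmem : ∀ A : Finset V, ∀ᶠ i in (U : Filter (Finset V × ℕ)), A ⊆ i.1 := fun A =>
    hU (tendsto_fst.eventually (eventually_ge_atTop A))
  have ht : Tendsto (fun i : Finset V × ℕ => t i.2) U (𝓝 1) :=
    (tendsto_natCast_div_add_atTop (1 : ℝ)).comp (tendsto_snd.mono_left hU)
  have hlim : ∀ x, ∃ a ∈ Set.Icc (0 : ℝ) 1, Tendsto (fun i => c i x) U (𝓝 a) := fun x =>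
    isCompact_Icc.ultrafilter_le_nhds (U.map fun i => c i x)
      (le_principal_iff.2 (Ultrafilter.mem_map.2 (univ_mem' fun i => hc i x)))
  choose d hd hlim using hlim
  refine ⟨d, hd, hp, fun x => ?_⟩
  have h1 : Tendsto (fun i : Finset V × ℕ => t i.2 * p x) U (𝓝 (p x)) := by
    simpa using ht.mul_const (p x)
  have h2 : Tendsto (fun i => c i x * ∏ w ∈ lesserNeighbors G x, (1 - c i w)) U
      (𝓝 (d x * ∏ w ∈ lesserNeighbors G x, (1 - d w))) :=
    (hlim x).mul (tendsto_finsetProd _ fun w _ => tendsto_const_nhds.sub (hlim w))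
  refine tendsto_nhds_unique h1 (h2.congr' ?_)
  -- By local finiteness the finite set eventually contains all lesser neighbours of `x`, and its
  -- equation at `x` is then the full one.
  filter_upwards [hmem (insert x (lesserNeighbors G x))] with i hi
  rw [hcp i x (hi (Finset.mem_insert_self _ _))]
  congr 1
  refine Finset.prod_congr (Finset.ext fun w => ?_) fun _ _ => rfl
  rw [Finset.mem_filter, mem_lesserNeighbors]
  exact ⟨fun hw => ⟨hi (Finset.mem_insert_of_mem (mem_lesserNeighbors.2 hw)), hw⟩, fun hw => hw.2⟩

end ShearerChordal

/-! ### Probability: Shearer's law and the block factor -/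

namespace ShearerChordal

/-- A `1`-dependent law under which adjacent vertices almost surely do not both take the
value `1` is Shearer's law. -/
theorem isShearerLaw_of_ae {V : Type*} {G : SimpleGraph V} {p : V → ℝ} {μ : Measure (V → Fin 2)}
    (hμ : μ ∈ oneDependentLaws G p) (hadj : ∀ x y, G.Adj x y → ∀ᵐ ω ∂μ, ω x = 1 → ω y = 0) :
    IsShearerLaw G p μ := by
  classical
  refine ⟨hμ, fun W => ?_⟩
  obtain ⟨hprob, hdep, hmarg⟩ := hμ
  induction W using Finset.strongInduction with
  | H W ih =>
  rcases W.eq_empty_or_nonempty with rfl | ⟨v, hv⟩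
  · simp [indepSetPoly_empty]
  have hv' := Finset.notMem_erase v W
  -- Avoidance of `W.erase v` is split by the value at `v`. A one at `v` already forces zeros at its
  -- neighbours, and is independent of the field on `N`; this reproduces the deletion recursion.
  set N : Finset V := {x ∈ W.erase v | ¬ G.Adj v x} with hN
  have hNW : N ⊂ W := (Finset.filter_subset _ _).trans_ssubset (Finset.erase_ssubset hv)
  have hmeas : MeasurableSet {ω : V → Fin 2 | ω v = 1} :=
    measurable_pi_apply v (measurableSet_singleton 1)
  have hsplit := measureReal_inter_add_sdiff (μ := μ)
    (s := {ω : V → Fin 2 | ∀ x ∈ W.erase v, ω x = 0}) hmeas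
  have hdiff : ({ω : V → Fin 2 | ∀ x ∈ W.erase v, ω x = 0} \ {ω | ω v = 1}) =
      {ω | ∀ x ∈ W, ω x = 0} := by
    ext ω
    have h01 : ¬ ω v = 1 ↔ ω v = 0 := by omega
    simp only [Set.mem_sdiff, Set.mem_ofPred_eq, h01]
    conv_rhs => rw [← Finset.insert_erase hv]
    rw [Finset.forall_mem_insert, and_comm]
  have hae : μ.real ({ω : V → Fin 2 | ∀ x ∈ W.erase v, ω x = 0} ∩ {ω | ω v = 1}) =
      μ.real ({ω | ω v = 1} ∩ {ω | ∀ x ∈ N, ω x = 0}) := by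
    refine measureReal_congr ?_
    have h : ∀ᵐ ω ∂μ, ∀ x ∈ W, G.Adj v x → ω v = 1 → ω x = 0 := by
      refine (Filter.eventually_all_finset W).2 fun x _ => ?_
      by_cases hvx : G.Adj v x
      · filter_upwards [hadj v x hvx] with ω hω _ using hω
      · exact Filter.Eventually.of_forall fun ω h => absurd h hvx
    filter_upwards [h] with ω hω
    refine propext ⟨fun h1 => ⟨h1.2, fun x hx => h1.1 x (Finset.mem_filter.1 hx).1⟩,
      fun h1 => ⟨fun x hx => ?_, h1.1⟩⟩
    by_cases hvx : G.Adj v x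
    · exact hω x (Finset.mem_erase.1 hx).2 hvx h1.1
    · exact h1.2 x (Finset.mem_filter.2 ⟨hx, hvx⟩)
  have hind : μ.real ({ω | ω v = 1} ∩ {ω | ∀ x ∈ N, ω x = 0}) =
      μ.real {ω | ω v = 1} * μ.real {ω | ∀ x ∈ N, ω x = 0} := by
    have h := hdep {v} (N : Set V) (by
      intro x hx y hy
      rw [Set.mem_singleton_iff] at hx
      subst hx
      have hy' := Finset.mem_filter.1 (Finset.mem_coe.1 hy)
      by_contra hle
      rcases SimpleGraph.edist_le_one_iff_adj_or_eq.1 (not_lt.1 hle) with h | h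
      · exact hy'.2 h
      · exact (Finset.mem_erase.1 hy'.1).1 h.symm)
    have hs : MeasurableSet {f : ({v} : Set V) → Fin 2 | f ⟨v, rfl⟩ = 1} :=
      measurable_pi_apply (⟨v, rfl⟩ : ({v} : Set V)) (measurableSet_singleton 1)
    have ht : MeasurableSet {f : ↥(N : Set V) → Fin 2 | ∀ x, f x = 0} := by
      rw [Set.ofPred_forall]
      exact MeasurableSet.iInter fun x => measurable_pi_apply x (measurableSet_singleton 0)
    have h' := h.measure_inter_preimage_eq_mul _ _ hs ht
    have e1 : ((fun (ω : V → Fin 2) (x : ({v} : Set V)) => ω x) ⁻¹'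
      {f : ({v} : Set V) → Fin 2 | f ⟨v, rfl⟩ = 1}) = {ω | ω v = 1} := rfl
    have e2 : ((fun (ω : V → Fin 2) (x : (N : Set V)) => ω x) ⁻¹'
      {f : ↥(N : Set V) → Fin 2 | ∀ x, f x = 0}) = {ω | ∀ x ∈ N, ω x = 0} := by
      ext ω
      simp
    rw [e1, e2] at h'
    simp only [measureReal_def, h', ENNReal.toReal_mul]
  rw [hdiff, hae, hind, hmarg, ih _ (Finset.erase_ssubset hv), ih _ hNW] at hsplit
  have hrec := indepSetPoly_insert G p hv'
  rw [Finset.insert_erase hv] at hrec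
  have hN' : indepSetPoly G p N = indepSetPoly G p {x ∈ W.erase v | ¬ G.Adj v x} := by
    congr 1
  rw [hrec]
  convert (eq_sub_of_add_eq' hsplit) using 3

theorem blockFactor_eq_one_iff {V Ω : Type*} [PartialOrder V] {G : SimpleGraph V}
    [G.LocallyFinite] {Y : V → Ω → Fin 2} {x : V} {ω : Ω} :
    blockFactor G Y x ω = 1 ↔ Y x ω = 1 ∧ ∀ w ∈ lesserNeighbors G x, Y w ω = 0 := by
  have h := blockFactor_coe G Y x ω
  have h01 : ∀ a : Fin 2, a = 0 ∨ a = 1 := by decide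
  constructor
  · intro h1
    rw [h1] at h
    constructor
    · rcases h01 (Y x ω) with h2 | h2
      · rw [h2] at h
        simp at h
      · exact h2
    · intro w hw
      rcases h01 (Y w ω) with h2 | h2
      · exact h2
      · rw [Finset.prod_eq_zero hw (by rw [h2]; simp)] at h
        simp at h
  · rintro ⟨h1, h2⟩
    rw [Finset.prod_eq_one (fun w hw => by rw [h2 w hw]; simp), h1] at h
    rcases h01 (blockFactor G Y x ω) with h3 | h3
    · rw [h3] at h
      simp at h
    · exact h3

theorem measurable_fin_two {Ω : Type*} {m : MeasurableSpace Ω} {f : Ω → Fin 2}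
    (h : MeasurableSet {ω | f ω = 1}) : Measurable f := by
  refine measurable_to_countable' fun a => ?_
  have h01 : a = 0 ∨ a = 1 := by omega
  rcases h01 with rfl | rfl
  · convert h.compl using 1
    ext ω
    simp only [Set.mem_preimage, Set.mem_singleton_iff, Set.mem_compl_iff, Set.mem_ofPred_eq]
    omega
  · exact h

theorem measurable_blockFactor {V Ω : Type*} [PartialOrder V] {G : SimpleGraph V}
    [G.LocallyFinite] {m : MeasurableSpace Ω} {Y : V → Ω → Fin 2} {x : V} (hx : Measurable (Y x))
    (hL : ∀ w ∈ lesserNeighbors G x, Measurable (Y w)) : Measurable (blockFactor G Y x) := by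
  refine measurable_fin_two ?_
  simp only [blockFactor_eq_one_iff, Set.ofPred_and]
  refine (hx (measurableSet_singleton 1)).inter ?_
  simp only [Set.ofPred_forall]
  exact Finset.measurableSet_biInter _ fun w hw => hL w hw (measurableSet_singleton 0)

/-- Block factors over vertex sets at distance greater than one are independent. -/
theorem indepFun_blockFactor {V Ω : Type*} [PartialOrder V] {G : SimpleGraph V}
    [G.LocallyFinite] (hG : IsLeftHanded G) (hV : IsTreeOrder V) [MeasurableSpace Ω]
    {P : Measure Ω} {c : V → ℝ} {Y : V → Ω → Fin 2} (hY : IsIndepBernoulli c Y P)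
    {U W : Set V} (h : ∀ x ∈ U, ∀ y ∈ W, 1 < G.edist x y) :
    IndepFun (fun ω (x : U) => blockFactor G Y x ω) (fun ω (y : W) => blockFactor G Y y ω) P := by
  have hne : ∀ x ∈ U, ∀ y ∈ W, ¬ (G.Adj x y ∨ x = y) := fun x hx y hy h' =>
    (h x hx y hy).not_ge (SimpleGraph.edist_le_one_iff_adj_or_eq.2 h')
  -- The vertices whose `Y` enters the block factors over `A`. For `U` and `W` these sets are
  -- disjoint, because vertices sharing a lesser neighbour are equal or adjacent.
  let cl : Set V → Set V := fun A => {w | w ∈ A ∨ ∃ x ∈ A, w ∈ lesserNeighbors G x}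
  have hdisj : Disjoint (cl U) (cl W) := by
    rw [Set.disjoint_left]
    rintro w (hwU | ⟨x, hx, hwx⟩) (hwW | ⟨y, hy, hwy⟩)
    · exact hne w hwU w hwW (Or.inr rfl)
    · exact hne w hwU y hy (Or.inl (mem_lesserNeighbors.1 hwy).2.symm)
    · exact hne x hx w hwW (Or.inl (mem_lesserNeighbors.1 hwx).2)
    · rw [mem_lesserNeighbors] at hwx hwy
      by_cases hxy : x = y
      · exact hne x hx y hy (Or.inr hxy)
      · exact hne x hx y hy (Or.inl (hG.adj_of_le hV hwx.1 hwy.1 hwx.2 hwy.2 hxy))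
  have hcl : ∀ A : Set V, MeasurableSpace.comap (fun ω (x : A) => blockFactor G Y x ω) inferInstance
      ≤ ⨆ w ∈ cl A, MeasurableSpace.comap (Y w) inferInstance := by
    intro A
    rw [← measurable_iff_comap_le]
    have hYm : ∀ w ∈ cl A, Measurable[⨆ w ∈ cl A, MeasurableSpace.comap (Y w) inferInstance]
        (Y w) := fun w hw => by
      rw [measurable_iff_comap_le]
      exact le_iSup₂_of_le w hw le_rfl
    refine @measurable_pi_lambda _ _ _ (_) _ _ fun x => ?_
    exact measurable_blockFactor (hYm x (Or.inl x.2)) fun w hw => hYm w (Or.inr ⟨x, x.2, hw⟩)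
  rw [IndepFun_iff_Indep]
  refine indep_of_indep_of_le_left (indep_of_indep_of_le_right ?_ (hcl W)) (hcl U)
  exact indep_iSup_of_disjoint (fun w => (hY.measurable w).comap_le)
    ((iIndepFun_iff_iIndep _ _ _).1 hY.indep) hdisj

theorem IsIndepBernoulli.real_eq_zero {V Ω : Type*} [MeasurableSpace Ω] {P : Measure Ω}
    [IsProbabilityMeasure P] {c : V → ℝ} {Y : V → Ω → Fin 2} (hY : IsIndepBernoulli c Y P)
    (x : V) : P.real {ω | Y x ω = 0} = 1 - c x := by
  have h := probReal_compl_eq_one_sub (μ := P) (hY.measurable x (measurableSet_singleton 1))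
  rw [← hY.marginal x]
  refine Eq.trans ?_ h
  congr 1
  ext ω
  simp only [Set.mem_preimage, Set.mem_singleton_iff, Set.mem_compl_iff, Set.mem_ofPred_eq]
  omega

theorem IsIndepBernoulli.real_blockFactor {V Ω : Type*} [PartialOrder V] {G : SimpleGraph V}
    [G.LocallyFinite] [MeasurableSpace Ω] {P : Measure Ω}
    [IsProbabilityMeasure P] {c : V → ℝ} {Y : V → Ω → Fin 2} (hY : IsIndepBernoulli c Y P)
    (x : V) : P.real {ω | blockFactor G Y x ω = 1} =
      c x * ∏ w ∈ lesserNeighbors G x, (1 - c w) := by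
  classical
  have hx : x ∉ lesserNeighbors G x := fun h => G.irrefl (mem_lesserNeighbors.1 h).2
  have h := hY.indep.measure_inter_preimage_eq_mul (insert x (lesserNeighbors G x))
    (sets := fun w => if w = x then {1} else {0}) (fun w _ => MeasurableSet.of_discrete)
  have e : {ω | blockFactor G Y x ω = 1} = ⋂ w ∈ insert x (lesserNeighbors G x),
      Y w ⁻¹' (if w = x then {1} else {0}) := by
    ext ω
    simp only [blockFactor_eq_one_iff, Set.mem_ofPred_eq, Set.mem_iInter, Set.mem_preimage,
      Finset.forall_mem_insert, if_true, Set.mem_singleton_iff]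
    refine and_congr_right fun _ => forall₂_congr fun w hw => ?_
    rw [if_neg (ne_of_mem_of_not_mem hw hx), Set.mem_singleton_iff]
  rw [measureReal_def, e, h, Finset.prod_insert hx, ENNReal.toReal_mul, ENNReal.toReal_prod]
  congr 1
  · rw [if_pos rfl]
    exact hY.marginal x
  · refine Finset.prod_congr rfl fun w hw => ?_
    rw [if_neg (ne_of_mem_of_not_mem hw hx)]
    exact hY.real_eq_zero w

/-- The block factor has Shearer's law. -/
theorem IsLeftHanded.isShearerLaw_blockFactor {V Ω : Type*} [PartialOrder V] {G : SimpleGraph V}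
    [G.LocallyFinite] (hG : IsLeftHanded G) (hV : IsTreeOrder V) {c p : V → ℝ}
    (hcp : EqualCorrespondence G c p) [MeasurableSpace Ω]
    {P : Measure Ω} [IsProbabilityMeasure P] {Y : V → Ω → Fin 2} (hY : IsIndepBernoulli c Y P) :
    IsShearerLaw G p (P.map (fun ω x => blockFactor G Y x ω)) := by
  have hm : Measurable (fun ω x => blockFactor G Y x ω) := measurable_pi_lambda _ fun x =>
    measurable_blockFactor (hY.measurable x) fun w _ => hY.measurable w
  refine isShearerLaw_of_ae ⟨Measure.isProbabilityMeasure_map hm.aemeasurable, ?_, ?_⟩ ?_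
  · intro U W h
    have hind := indepFun_blockFactor hG hV hY h
    rw [indepFun_iff_measure_inter_preimage_eq_mul] at hind ⊢
    intro s t hs ht
    have hU : Measurable (fun (ω : V → Fin 2) (x : U) => ω x) := by fun_prop
    have hW : Measurable (fun (ω : V → Fin 2) (x : W) => ω x) := by fun_prop
    rw [Measure.map_apply hm ((hU hs).inter (hW ht)), Measure.map_apply hm (hU hs),
      Measure.map_apply hm (hW ht)]
    exact hind s t hs ht
  · intro x
    rw [hcp.eq x, ← hY.real_blockFactor x]
    exact map_measureReal_apply hm (measurable_pi_apply x (measurableSet_singleton 1))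
  · intro x y hxy
    have hs : MeasurableSet {ω : V → Fin 2 | ω x = 1 → ω y = 0} := by
      have : {ω : V → Fin 2 | ω x = 1 → ω y = 0} =
          {ω : V → Fin 2 | ω x = 1}ᶜ ∪ {ω | ω y = 0} := by
        ext ω
        simp [imp_iff_not_or]
      rw [this]
      exact (measurable_pi_apply x (measurableSet_singleton 1)).compl.union
        (measurable_pi_apply y (measurableSet_singleton 0))
    rw [ae_map_iff hm.aemeasurable hs]
    refine Filter.Eventually.of_forall fun ω h1 => ?_
    by_contra h0
    have h2 : blockFactor G Y y ω = 1 := Fin.eq_one_of_ne_zero _ h0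
    rw [blockFactor_eq_one_iff] at h1 h2
    have h01 : (1 : Fin 2) ≠ 0 := by decide
    -- One of the two is a lesser neighbour of the other: a one at the greater needs `Y = 0` at the
    -- lesser, a one at the lesser needs `Y = 1` there.
    rcases hG.comparable x y hxy with h | h
    · exact h01 (h2.1.symm.trans (h1.2 y (mem_lesserNeighbors.2 ⟨h, hxy⟩)))
    · exact h01 (h1.1.symm.trans (h2.2 x (mem_lesserNeighbors.2 ⟨h, hxy.symm⟩)))

/-- The Bernoulli measure on `{0,1}` with parameter `a`. -/
noncomputable def bernoulliFinTwo (a : ℝ) : Measure (Fin 2) :=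
  ENNReal.ofReal a • Measure.dirac 1 + ENNReal.ofReal (1 - a) • Measure.dirac 0

theorem isProbabilityMeasure_bernoulliFinTwo {a : ℝ} (ha : a ∈ Set.Icc (0 : ℝ) 1) :
    IsProbabilityMeasure (bernoulliFinTwo a) := by
  refine ⟨?_⟩
  simp only [bernoulliFinTwo, Measure.coe_add, Measure.coe_smul, Pi.add_apply, Pi.smul_apply,
    measure_univ, smul_eq_mul, mul_one]
  rw [← ENNReal.ofReal_add ha.1 (by linarith [ha.2])]
  simp

theorem exists_isIndepBernoulli {V : Type*} {c : V → ℝ} (hc : ∀ x, c x ∈ Set.Icc (0 : ℝ) 1) :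
    ∃ P : Measure (V → Fin 2), IsProbabilityMeasure P ∧
      IsIndepBernoulli c (fun x ω => ω x) P := by
  have := fun x => isProbabilityMeasure_bernoulliFinTwo (hc x)
  refine ⟨Measure.infinitePi fun x => bernoulliFinTwo (c x), inferInstance, ?_, ?_, ?_⟩
  · exact fun x => measurable_pi_apply x
  · exact iIndepFun_infinitePi (X := fun _ a => a) fun _ => measurable_id
  · intro x
    have h := map_measureReal_apply (μ := Measure.infinitePi fun x => bernoulliFinTwo (c x))
      (measurable_pi_apply x) (measurableSet_singleton (1 : Fin 2))
    rw [Measure.infinitePi_map_eval] at h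
    refine h.symm.trans ?_
    rw [measureReal_def]
    simp [bernoulliFinTwo, (hc x).1]

end ShearerChordal

theorem mainTheorem4 {V : Type*} (G : SimpleGraph V) [G.LocallyFinite]
    (hconn : G.Connected) (hchordal : IsChordal G) :
    (∃ _ : PartialOrder V, IsTreeOrder V ∧ IsLeftHanded G) ∧
    ∀ _ : PartialOrder V, IsTreeOrder V → IsLeftHanded G →
      ∀ p : V → ℝ, (∀ x, p x ∈ Set.Icc (0 : ℝ) 1) →
        ((∃ μ : Measure (V → Fin 2), IsShearerLaw G p μ) ↔ p ∈ equalSet G) ∧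
        ∀ c : V → ℝ, EqualCorrespondence G c p →
          ∀ (Ω : Type*) [MeasurableSpace Ω] (P : Measure Ω) [IsProbabilityMeasure P]
            (Y : V → Ω → Fin 2), IsIndepBernoulli c Y P →
            IsShearerLaw G p (P.map (fun ω x => blockFactor G Y x ω)) := by
  refine ⟨hchordal.exists_treeOrder, fun _ hV hG p hp => ⟨⟨?_, ?_⟩, ?_⟩⟩
  · rintro ⟨μ, hμ⟩
    exact hG.mem_equalSet hV hp fun W => hμ.2 W ▸ measureReal_nonneg
  · rintro ⟨c, hcp⟩
    obtain ⟨P, hP, hY⟩ := exists_isIndepBernoulli hcp.left_mem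
    exact ⟨_, hG.isShearerLaw_blockFactor hV hcp hY⟩
  · intro c hcp Ω _ P _ Y hY
    exact hG.isShearerLaw_blockFactor hV hcp hY
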